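/- Let $f:[0,\infty)\to\mathbb R$ be a twice continuously differentiable (one-sided derivatives at $0$), strictly positive function such that $$(f'(x))^2\le f''(x)\,f(x)\qquad\text{for all }x\in[0,\infty),$$ and put $a_n=f(n)$, $n=0,1,2,\dots$. Let $\Omega\subset\mathbb C$ be a domain (non-empty, open, connected) such that the series $$K(z,w)=\sum_{n=0}^\infty a_n z^n\overline{w}^{\,n}$$ converges absolutely for all $z,w\in\Omega$ (for instance $\Omega=\{z\in\mathbb C:|z|^2<R\}$, if the radius of convergence $R$ of $\sum_n a_nt^n$ is positive). Then $K$ is a complete Nevanlinna–Pick kernel on $\Omega$. Here a function $K:\Omega\times\Omega\to\mathbb C$ is called a complete Nevanlinna–Pick kernel if it is a positive definite kernel (that is, all the matrices $(K(z_i,z_j))_{i,j}$ are Hermitian and positive semidefinite) and, with $\mathcal H(K)$ the reproducing kernel Hilbert space with kernel $K$, the following holds for all non-negative integers $m,p,q$, all $w_1,\dots,w_m\in\Omega$ and all $S_1,\dots,S_m\in\mathbb C^{p\times q}$: there is a Schur multiplier $S$, i.e. a function $S:\Omega\to\mathbb C^{p\times q}$ for which multiplication by $S$ is a contraction from $\mathcal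 H(K)^q$ into $\mathcal H(K)^p$, with $S(w_j)=S_j$ for $j=1,\dots,m$, if and only if the block matrix $$\big((I_p-S_jS_\ell^*)\,K(w_j,w_\ell)\big)_{j,\ell=1}^m$$ is Hermitian and positive semidefinite. -/

import Mathlib

open scoped ComplexOrder

/-- A positive definite kernel on `X` (in the sense of reproducing kernels): `K` is Hermitian and
`∑ i, ∑ j, conj (c i) * K (x i) (x j) * c j ≥ 0` for all finite families. -/
def IsPosDefKernel {X : Type*} (K : X → X → ℂ) : Prop :=
  (Matrix.of K).PosSemidef

/-- The scalar kernel `K`, seen as a kernel whose values are operators on the space `ℂ`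
(multiplication by `K z w`), which is the form used for `RKHS.OfKernel`. -/
noncomputable def opKernel {X : Type*} (K : X → X → ℂ) : Matrix X X (ℂ →L[ℂ] ℂ) :=
  Matrix.of fun z w => K z w • (1 : ℂ →L[ℂ] ℂ)

theorem IsPosDefKernel.posSemidef_opKernel {X : Type*} {K : X → X → ℂ} (hK : IsPosDefKernel K) :
    (opKernel K).PosSemidef := by
  have hH : (opKernel K).IsHermitian := by
    ext z w
    have h := hK.isHermitian.apply z w
    simp only [Matrix.of_apply] at h
    simp [opKernel, Matrix.conjTranspose_apply, ← h]
  have t := (RKHS.posSemidef_tfae (K := opKernel K)).out 0 2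
  refine t.mpr ⟨hH, fun v => ?_⟩
  have h := (Complex.le_def.mp (hK.2 v)).1
  have e : (v.sum fun x u => v.sum fun y w => inner ℂ ((opKernel K y x) u) w) =
      star (v.sum fun i xi => v.sum fun j xj => star xi * Matrix.of K i j * xj) := by
    rw [Finsupp.sum_comm]
    simp [opKernel, Finsupp.sum, mul_comm, mul_left_comm]
  rw [e, RCLike.star_def, RCLike.conj_re]
  exact h

/-- The reproducing kernel Hilbert space `ℋ(K)` of functions `X → ℂ` with kernel `K`. -/
abbrev KernelSpace {X : Type*} (K : X → X → ℂ) [Fact (opKernel K).PosSemidef] :=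
  RKHS.OfKernel (opKernel K)

/-- `S : X → ℂ^{p × q}` is a contractive multiplier (Schur multiplier) of the reproducing kernel
Hilbert space `H` of functions `X → ℂ`: the multiplication `F ↦ S F` is a contraction from the
Hilbert space direct sum `H^q` into `H^p`. -/
def IsSchurMultiplier {X : Type*} (H : Type*) [NormedAddCommGroup H] [InnerProductSpace ℂ H]
    [RKHS ℂ H X ℂ] {p q : ℕ} (S : X → Matrix (Fin p) (Fin q) ℂ) : Prop :=
  ∃ M : PiLp 2 (fun _ : Fin q => H) →ₗ[ℂ] PiLp 2 (fun _ : Fin p => H),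
    (∀ F, ‖M F‖ ≤ ‖F‖) ∧ ∀ (F : PiLp 2 (fun _ : Fin q => H)) (z : X) (i : Fin p),
      (M F i) z = ∑ j, S z i j * (F j) z

/-- The block matrix `((I_p - S_j S_ℓ^*) K(w_j, w_ℓ))_{j,ℓ}` of an interpolation problem. -/
def pickMatrix {X : Type*} (K : X → X → ℂ) {m p q : ℕ} (w : Fin m → X)
    (S : Fin m → Matrix (Fin p) (Fin q) ℂ) : Matrix (Fin m × Fin p) (Fin m × Fin p) ℂ :=
  Matrix.of fun a b => ((1 : Matrix (Fin p) (Fin p) ℂ) - S a.1 * (S b.1).conjTranspose) a.2 b.2 * K (w a.1) (w b.1)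

/-- `K` is a complete Nevanlinna-Pick kernel: it is a positive definite kernel and, for matrices of
every size and every finite set of data, nonnegativity of the Pick matrix is necessary and
sufficient for the existence of an interpolating Schur multiplier of `ℋ(K)`. -/
def IsCNPKernel {X : Type*} (K : X → X → ℂ) : Prop :=
  ∃ hK : IsPosDefKernel K,
    haveI : Fact (opKernel K).PosSemidef := ⟨hK.posSemidef_opKernel⟩
    ∀ (m p q : ℕ) (w : Fin m → X) (s : Fin m → Matrix (Fin p) (Fin q) ℂ),
      (∃ S : X → Matrix (Fin p) (Fin q) ℂ,
        IsSchurMultiplier (KernelSpace K) S ∧ ∀ j, S (w j) = s j) ↔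
      (pickMatrix K w s).PosSemidef

/-!
Since `f` is log-convex, so is the sequence `aₙ = f n`, and by Kaluza's lemma the power series
`1 - a₀ / ∑ aₙ Xⁿ` has nonnegative coefficients `bₙ`. With `k(z, w) = z * conj w`, the Schur product
theorem makes both `K = ∑ aₙ kⁿ` and `B = ∑ bₙ kⁿ` positive definite, and `K (1 - B) = a₀`.

This identity alone gives the complete Pick property, by a lurking isometry argument. Write
`B(x, y) = ⟪e x, e y⟫`, so that `‖e x‖ < 1`, and factor a positive semidefinite Pick matrix as
`a₀ ⟪g_{j,i}, g_{l,k}⟫`. Then the vectors `(ε_i, e(w_j) ⊗ g_{j,i})` and `(S_j^* ε_i, g_{j,i})` have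
the same Gram matrix, so a contraction `T` maps the former to the latter. As `‖e x‖ < 1`, solving
`T (ε_i, e(x) ⊗ h) = (S(x)^* ε_i, h)` at each `x` determines `h` and `S(x)`; the resulting `S`
interpolates, and `‖T‖ ≤ 1` makes `(I - S(x) S(y)^*) K(x, y)` positive semidefinite.
-/

section Gram

open Matrix

variable {ι U V : Type*} [NormedAddCommGroup U] [InnerProductSpace ℂ U]
  [NormedAddCommGroup V] [InnerProductSpace ℂ V]

theorem finsuppSum_gram_eq_norm_sq (u : ι → U) (c : ι →₀ ℂ) :
    (c.sum fun i ci ↦ c.sum fun j cj ↦ star ci * gram ℂ u i j * cj) =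
      ((‖Finsupp.linearCombination ℂ u c‖ ^ 2 : ℝ) : ℂ) := by
  have h := inner_self_eq_norm_sq_to_K (𝕜 := ℂ) (Finsupp.linearCombination ℂ u c)
  rw [Complex.ofReal_pow]
  refine Eq.trans ?_ h
  simp only [Finsupp.linearCombination_apply, Finsupp.sum, sum_inner, inner_sum,
    inner_smul_left, inner_smul_right, Finset.mul_sum, gram_apply, RCLike.star_def]
  rw [Finset.sum_comm]
  exact Finset.sum_congr rfl fun i _ ↦ Finset.sum_congr rfl fun j _ ↦ by ring

theorem posSemidef_gram_sub_gram_iff (u : ι → U) (v : ι → V) :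
    (gram ℂ u - gram ℂ v).PosSemidef ↔ ∀ c : ι →₀ ℂ,
      ‖Finsupp.linearCombination ℂ v c‖ ≤ ‖Finsupp.linearCombination ℂ u c‖ := by
  have hsum (c : ι →₀ ℂ) :
      0 ≤ (c.sum fun i ci ↦ c.sum fun j cj ↦ star ci * (gram ℂ u - gram ℂ v) i j * cj) ↔
        ‖Finsupp.linearCombination ℂ v c‖ ≤ ‖Finsupp.linearCombination ℂ u c‖ := by
    simp only [Matrix.sub_apply, mul_sub, sub_mul, Finsupp.sum_sub, finsuppSum_gram_eq_norm_sq]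
    rw [← Complex.ofReal_sub, Complex.zero_le_real, sub_nonneg,
      sq_le_sq₀ (norm_nonneg _) (norm_nonneg _)]
  simp only [PosSemidef, hsum, (isHermitian_gram ℂ u).sub (isHermitian_gram ℂ v), true_and]

theorem exists_contraction_of_norm_linearCombination_le [CompleteSpace U] [CompleteSpace V]
    {u : ι → U} {v : ι → V}
    (h : ∀ c : ι →₀ ℂ,
      ‖Finsupp.linearCombination ℂ v c‖ ≤ ‖Finsupp.linearCombination ℂ u c‖) :
    ∃ T : U →L[ℂ] V, ‖T‖ ≤ 1 ∧ ∀ i, T (u i) = v i := by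
  let L := Finsupp.linearCombination ℂ u
  let R := Finsupp.linearCombination ℂ v
  let W := (LinearMap.range L).topologicalClosure
  let e : (ι →₀ ℂ) →ₗ[ℂ] W :=
    L.codRestrict W fun c ↦ Submodule.le_topologicalClosure _ ⟨c, rfl⟩
  have hdense : DenseRange e := by
    intro x
    have himage : ((↑) '' Set.range e : Set U) = LinearMap.range L := by
      ext y
      simp [e]
    rw [closure_subtype, himage]
    exact x.2
  have hbound (c : ι →₀ ℂ) : ‖R c‖ ≤ 1 * ‖e c‖ := (h c).trans_eq (one_mul _).symm
  have : CompleteSpace W := (Submodule.isClosed_topologicalClosure _).completeSpace_coe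
  refine ⟨(R.extendOfNorm e).comp W.orthogonalProjectionOnto, ?_, fun i ↦ ?_⟩
  · refine ContinuousLinearMap.opNorm_le_bound _ zero_le_one fun x ↦ ?_
    calc ‖R.extendOfNorm e (W.orthogonalProjectionOnto x)‖
        ≤ 1 * ‖W.orthogonalProjectionOnto x‖ :=
          LinearMap.norm_extendOfNorm_apply_le hdense 1 hbound _
      _ ≤ 1 * ‖x‖ := by
          gcongr
          exact W.norm_orthogonalProjectionOnto_apply_le x
  · have hu : u i = (e (Finsupp.single i 1) : U) := by simp [e, L]
    rw [ContinuousLinearMap.comp_apply, hu,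
      Submodule.orthogonalProjectionOnto_mem_subspace_eq_self,
      LinearMap.extendOfNorm_eq hdense ⟨1, hbound⟩]
    simp [R]

theorem posSemidef_gram_sub_gram_iff_exists_contraction [CompleteSpace U] [CompleteSpace V]
    (u : ι → U) (v : ι → V) :
    (gram ℂ u - gram ℂ v).PosSemidef ↔ ∃ T : U →L[ℂ] V, ‖T‖ ≤ 1 ∧ ∀ i, T (u i) = v i := by
  rw [posSemidef_gram_sub_gram_iff]
  refine ⟨exists_contraction_of_norm_linearCombination_le, ?_⟩
  rintro ⟨T, hT, hTu⟩ c
  have hv : Finsupp.linearCombination ℂ v c = T (Finsupp.linearCombination ℂ u c) := by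
    simp [Finsupp.linearCombination_apply, Finsupp.sum, hTu]
  rw [hv]
  exact T.le_of_opNorm_le_of_le hT le_rfl |>.trans_eq (one_mul _)

end Gram

section EvaluationVectors

variable {X : Type*} {K : X → X → ℂ} {H : Type*} [NormedAddCommGroup H] [InnerProductSpace ℂ H]
  [CompleteSpace H] [RKHS ℂ H X ℂ]

variable (H) in
/-- The reproducing vector `K(·, x)` of a Hilbert space `H` of scalar functions. -/
noncomputable def evalVector (x : X) : H := RKHS.kerFun H x 1

theorem inner_evalVector (x : X) (F : H) : inner ℂ (evalVector H x) F = F x := by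
  simp [evalVector, RKHS.kerFun_inner]

theorem evalVector_apply (hK : RKHS.kernel H = opKernel K) (x y : X) :
    evalVector H y x = K x y := by
  simp [evalVector, RKHS.kerFun_apply, hK, opKernel]

end EvaluationVectors

namespace IsPosDefKernel

variable {X : Type*} {K L : X → X → ℂ}

theorem of_inner {E : Type*} [NormedAddCommGroup E] [InnerProductSpace ℂ E] (φ : X → E) :
    IsPosDefKernel fun x y ↦ inner ℂ (φ x) (φ y) :=
  ⟨Matrix.isHermitian_gram ℂ φ, fun c ↦
    (Complex.zero_le_real.mpr (sq_nonneg _)).trans_eq (finsuppSum_gram_eq_norm_sq φ c).symm⟩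

theorem mul_conj (φ : X → ℂ) : IsPosDefKernel fun x y ↦ φ x * starRingEnd ℂ (φ y) := by
  simpa [mul_comm] using of_inner fun x ↦ starRingEnd ℂ (φ x)

theorem exists_eq_inner.{u} {X : Type u} {K : X → X → ℂ} (hK : IsPosDefKernel K) :
    ∃ (E : Type u) (_ : NormedAddCommGroup E) (_ : InnerProductSpace ℂ E) (_ : CompleteSpace E)
      (φ : X → E), ∀ x y, K x y = inner ℂ (φ x) (φ y) := by
  have : Fact (opKernel K).PosSemidef := ⟨hK.posSemidef_opKernel⟩
  refine ⟨KernelSpace K, inferInstance, inferInstance, inferInstance, evalVector _, fun x y ↦ ?_⟩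
  rw [inner_evalVector, evalVector_apply RKHS.OfKernel.kernel_ofKernel]

theorem mul (hK : IsPosDefKernel K) (hL : IsPosDefKernel L) :
    IsPosDefKernel fun x y ↦ K x y * L x y :=
  Matrix.PosSemidef.hadamard hK hL

theorem pow (hK : IsPosDefKernel K) (n : ℕ) : IsPosDefKernel fun x y ↦ K x y ^ n := by
  induction n with
  | zero => simpa using of_inner fun _ : X ↦ (1 : ℂ)
  | succ n ih => simpa only [pow_succ] using ih.mul hK

theorem tsum {K : ℕ → X → X → ℂ} (hK : ∀ n, IsPosDefKernel (K n))
    (hsum : ∀ x y, Summable fun n ↦ K n x y) : IsPosDefKernel fun x y ↦ ∑' n, K n x y := by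
  refine ⟨Matrix.ext fun x y ↦ ?_, fun c ↦ ?_⟩
  · simpa [tsum_star] using tsum_congr fun n ↦ (hK n).isHermitian.apply x y
  · have hhas : HasSum (fun n ↦ c.sum fun x cx ↦ c.sum fun y cy ↦ star cx * K n x y * cy)
        (c.sum fun x cx ↦ c.sum fun y cy ↦ star cx * (∑' n, K n x y) * cy) :=
      hasSum_sum fun x _ ↦ hasSum_sum fun y _ ↦
        ((hsum x y).hasSum.mul_left _).mul_right _
    exact hhas.nonneg fun n ↦ (hK n).2 c

theorem tsum_mul_pow (hK : IsPosDefKernel K) {a : ℕ → ℝ} (ha : ∀ n, 0 ≤ a n)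
    (hsum : ∀ x y, Summable fun n ↦ (a n : ℂ) * K x y ^ n) :
    IsPosDefKernel fun x y ↦ ∑' n, (a n : ℂ) * K x y ^ n :=
  tsum (fun n ↦ (hK.pow n).smul (ha n)) hsum

end IsPosDefKernel

section SchurMultipliers

variable {X ι κ : Type*} {K : X → X → ℂ}

/-- The matrix-valued kernel `(I - S(z) S(w)^*) K(z, w)` of de Branges and Rovnyak, encoded as a
scalar matrix indexed by points and rows. It extends `pickMatrix` to infinitely many nodes. -/
def deBrangesRovnyakKernel [Fintype κ] [DecidableEq ι] (K : X → X → ℂ) (S : X → Matrix ι κ ℂ) :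
    Matrix (X × ι) (X × ι) ℂ :=
  Matrix.of fun a b ↦ ((1 : Matrix ι ι ℂ) - S a.1 * (S b.1).conjTranspose) a.2 b.2 * K a.1 b.1

variable {H : Type*} [NormedAddCommGroup H] [InnerProductSpace ℂ H]
  [CompleteSpace H] [RKHS ℂ H X ℂ] [Fintype ι] [Fintype κ]

section

variable [DecidableEq ι]

variable (H) in
/-- The vector of `H^ι` representing the evaluation `F ↦ F_i(x)`. -/
noncomputable def coordEvalVector (a : X × ι) : PiLp 2 fun _ : ι ↦ H :=
  PiLp.single 2 a.2 (evalVector H a.1)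

theorem inner_coordEvalVector (a : X × ι) (F : PiLp 2 fun _ : ι ↦ H) :
    inner ℂ (coordEvalVector H a) F = F a.2 a.1 := by
  rw [PiLp.inner_apply, Finset.sum_eq_single a.2]
  · simp [coordEvalVector, inner_evalVector]
  · intro i _ hi
    simp [coordEvalVector, hi]
  · simp

end

variable (H) in
/-- The vector of `H^κ` representing the evaluation `F ↦ (S F)_i(x)`. -/
noncomputable def multiplierEvalVector (S : X → Matrix ι κ ℂ) (a : X × ι) :
    PiLp 2 fun _ : κ ↦ H :=
  WithLp.toLp 2 fun j ↦ star (S a.1 a.2 j) • evalVector H a.1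

omit [Fintype ι] in
theorem inner_multiplierEvalVector (S : X → Matrix ι κ ℂ) (a : X × ι)
    (F : PiLp 2 fun _ : κ ↦ H) :
    inner ℂ (multiplierEvalVector H S a) F = ∑ j, S a.1 a.2 j * F j a.1 := by
  simp [multiplierEvalVector, PiLp.inner_apply, inner_smul_left, inner_evalVector]

theorem gram_coordEvalVector_sub_gram_multiplierEvalVector [DecidableEq ι]
    (hK : RKHS.kernel H = opKernel K) (S : X → Matrix ι κ ℂ) :
    Matrix.gram ℂ (coordEvalVector H) - Matrix.gram ℂ (multiplierEvalVector H S) =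
      deBrangesRovnyakKernel K S := by
  ext ⟨x, i⟩ ⟨y, k⟩
  rw [Matrix.sub_apply, Matrix.gram_apply, Matrix.gram_apply, inner_coordEvalVector,
    inner_multiplierEvalVector]
  have hcoord : coordEvalVector H (y, k) i x = (1 : Matrix ι ι ℂ) i k * K x y := by
    by_cases hik : i = k
    · subst hik
      simp [coordEvalVector, evalVector_apply hK]
    · simp [coordEvalVector, hik]
  rw [hcoord]
  simp [multiplierEvalVector, deBrangesRovnyakKernel, evalVector_apply hK, sub_mul,
    Matrix.mul_apply, Finset.sum_mul, mul_assoc]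

theorem isSchurMultiplier_iff_exists_contraction {p q : ℕ} (S : X → Matrix (Fin p) (Fin q) ℂ) :
    IsSchurMultiplier H S ↔ ∃ T : (PiLp 2 fun _ : Fin p ↦ H) →L[ℂ] PiLp 2 fun _ : Fin q ↦ H,
      ‖T‖ ≤ 1 ∧ ∀ a, T (coordEvalVector H a) = multiplierEvalVector H S a := by
  constructor
  · rintro ⟨M, hM, hMS⟩
    let M' := M.mkContinuous 1 fun F ↦ (hM F).trans_eq (one_mul _).symm
    refine ⟨M'.adjoint, ?_, fun a ↦ ext_inner_right ℂ fun F ↦ ?_⟩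
    · rw [LinearIsometryEquiv.norm_map]
      exact M.mkContinuous_norm_le zero_le_one _
    · rw [ContinuousLinearMap.adjoint_inner_left, inner_coordEvalVector,
        inner_multiplierEvalVector]
      exact hMS F a.1 a.2
  · rintro ⟨T, hT, hTS⟩
    have hTadj : ‖T.adjoint‖ ≤ 1 := by rwa [LinearIsometryEquiv.norm_map]
    refine ⟨T.adjoint.toLinearMap, fun F ↦ ?_, fun F z i ↦ ?_⟩
    · exact (T.adjoint.le_of_opNorm_le hTadj F).trans_eq (one_mul _)
    · calc T.adjoint F i z = inner ℂ (coordEvalVector H (z, i)) (T.adjoint F) :=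
            (inner_coordEvalVector (z, i) _).symm
        _ = inner ℂ (multiplierEvalVector H S (z, i)) F := by
            rw [ContinuousLinearMap.adjoint_inner_right, hTS]
        _ = ∑ j, S z i j * F j z := inner_multiplierEvalVector S (z, i) F

theorem isSchurMultiplier_iff_posSemidef (hK : RKHS.kernel H = opKernel K) {p q : ℕ}
    (S : X → Matrix (Fin p) (Fin q) ℂ) :
    IsSchurMultiplier H S ↔ (deBrangesRovnyakKernel K S).PosSemidef := by
  rw [← gram_coordEvalVector_sub_gram_multiplierEvalVector hK,
    posSemidef_gram_sub_gram_iff_exists_contraction, isSchurMultiplier_iff_exists_contraction]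

end SchurMultipliers

section Colligations

open UniformSpace TensorProduct

/-- Tensoring with `x` on the left, `g ↦ x ⊗ g`, into the Hilbert space tensor product (the
completion of the algebraic one). It carries a factor `⟪x, y⟫` of a kernel over to states `g`. -/
noncomputable def tensorLeft {E : Type*} (G : Type*) [NormedAddCommGroup E]
    [InnerProductSpace ℂ E] [NormedAddCommGroup G] [InnerProductSpace ℂ G] (x : E) :
    G →L[ℂ] Completion (E ⊗[ℂ] G) :=
  Completion.toComplL ∘L TensorProduct.mkL ℂ E G x

section TensorLeft

variable {E G : Type*} [NormedAddCommGroup E] [InnerProductSpace ℂ E]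
  [NormedAddCommGroup G] [InnerProductSpace ℂ G]

theorem inner_tensorLeft (x y : E) (g h : G) :
    inner ℂ (tensorLeft G x g) (tensorLeft G y h) = inner ℂ x y * inner ℂ g h := by
  simp [tensorLeft, Completion.inner_coe]

theorem norm_tensorLeft_le (x : E) : ‖tensorLeft G x‖ ≤ ‖x‖ :=
  ContinuousLinearMap.opNorm_le_bound _ (norm_nonneg x) fun g ↦ by
    simp [tensorLeft, Completion.norm_coe]

end TensorLeft

variable {X ι κ F G : Type*} [Fintype ι] [Fintype κ] [DecidableEq ι]
  [NormedAddCommGroup F] [InnerProductSpace ℂ F] [NormedAddCommGroup G] [InnerProductSpace ℂ G]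

theorem existsUnique_state [CompleteSpace G] {P Q : Type*} [NormedAddCommGroup P]
    [InnerProductSpace ℂ P] [NormedAddCommGroup Q] [InnerProductSpace ℂ Q]
    {T : WithLp 2 (P × F) →L[ℂ] WithLp 2 (Q × G)} (hT : ‖T‖ ≤ 1)
    {J : G →L[ℂ] F} (hJ : ‖J‖ < 1) (ξ : P) :
    ∃! g : G, (T (WithLp.toLp 2 (ξ, J g))).snd = g := by
  have hcontr : ContractingWith ‖J‖₊ fun g ↦ (T (WithLp.toLp 2 (ξ, J g))).snd := by
    refine ⟨hJ, LipschitzWith.of_dist_le_mul fun g h ↦ ?_⟩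
    simp only [dist_eq_norm, coe_nnnorm]
    calc ‖(T (WithLp.toLp 2 (ξ, J g))).snd - (T (WithLp.toLp 2 (ξ, J h))).snd‖
        = ‖(T (WithLp.toLp 2 (0, J (g - h)))).snd‖ := by
          rw [← WithLp.sub_snd, ← map_sub, ← WithLp.toLp_sub, Prod.mk_sub_mk, sub_self, map_sub]
      _ ≤ ‖T (WithLp.toLp 2 (0, J (g - h)))‖ := WithLp.norm_snd_le _ _
      _ ≤ 1 * ‖J (g - h)‖ := by
          rw [← WithLp.norm_toLp_snd 2 P F]
          exact T.le_of_opNorm_le hT _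
      _ ≤ ‖J‖ * ‖g - h‖ := (one_mul _).trans_le (J.le_opNorm _)
  exact ⟨hcontr.fixedPoint, hcontr.fixedPoint_isFixedPt, fun g hg ↦ hcontr.fixedPoint_unique hg⟩

/-- The vector `A^* ε_i`: the `i`-th row of `A`, with entries conjugated so that inner products
of rows are the entries of `A * B^*`. -/
noncomputable def conjRow (A : Matrix ι κ ℂ) (i : ι) : EuclideanSpace ℂ κ :=
  WithLp.toLp 2 fun l ↦ star (A i l)

omit [Fintype ι] [DecidableEq ι] in
theorem inner_conjRow (A B : Matrix ι κ ℂ) (i k : ι) :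
    inner ℂ (conjRow A i) (conjRow B k) = (A * B.conjTranspose) i k := by
  simp [conjRow, PiLp.inner_apply, Matrix.mul_apply, mul_comm]

omit [Fintype ι] [Fintype κ] [DecidableEq ι] in
theorem conjRow_injective :
    Function.Injective (conjRow : Matrix ι κ ℂ → ι → EuclideanSpace ℂ κ) := by
  intro A B h
  ext i l
  have := congrArg (fun v ↦ star (v i l)) h
  simpa [conjRow] using this

variable {E : Type*} [NormedAddCommGroup E] [InnerProductSpace ℂ E]

/-- The inputs `(ε_i, e(x) ⊗ h_{x,i})` of a colligation with states `h`, where `ε_i` is the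
standard basis. -/
noncomputable def colligationInput (e : X → E) (h : X × ι → G) (a : X × ι) :
    WithLp 2 (EuclideanSpace ℂ ι × Completion (E ⊗[ℂ] G)) :=
  WithLp.toLp 2 (EuclideanSpace.single a.2 1, tensorLeft G (e a.1) (h a))

/-- The outputs `(S(x)^* ε_i, h_{x,i})` of a colligation with states `h`. -/
noncomputable def colligationOutput (S : X → Matrix ι κ ℂ) (h : X × ι → G) (a : X × ι) :
    WithLp 2 (EuclideanSpace ℂ κ × G) :=
  WithLp.toLp 2 (conjRow (S a.1) a.2, h a)

/-- The colligation `T` realizes `S` with states `h`: with the blocks of `T` and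
`Z(x) = e(x) ⊗ ·`, this says `S(x)^* = T₁₁ + T₁₂ Z(x) (1 - T₂₂ Z(x))⁻¹ T₂₁`. -/
def IsRealization (T : WithLp 2 (EuclideanSpace ℂ ι × Completion (E ⊗[ℂ] G)) →L[ℂ]
    WithLp 2 (EuclideanSpace ℂ κ × G)) (e : X → E) (S : X → Matrix ι κ ℂ) (h : X × ι → G) : Prop :=
  ∀ a, T (colligationInput e h a) = colligationOutput S h a

theorem mul_gram_colligationInput_sub_gram_colligationOutput {K : X → X → ℂ} {e : X → E} {c : ℝ}
    (hKe : ∀ x y, K x y * (1 - inner ℂ (e x) (e y)) = c) (S : X → Matrix ι κ ℂ)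
    (h : X × ι → G) (a b : X × ι) :
    K a.1 b.1 * (Matrix.gram ℂ (colligationInput e h) -
        Matrix.gram ℂ (colligationOutput S h)) a b =
      deBrangesRovnyakKernel K S a b - c * inner ℂ (h a) (h b) := by
  have hbasis : inner ℂ (EuclideanSpace.single a.2 (1 : ℂ)) (EuclideanSpace.single b.2 (1 : ℂ)) =
      (1 : Matrix ι ι ℂ) a.2 b.2 := by
    simp [EuclideanSpace.inner_single_left, Matrix.one_apply]
  simp only [Matrix.sub_apply, Matrix.gram_apply, colligationInput, colligationOutput,
    WithLp.prod_inner_apply, inner_tensorLeft, inner_conjRow, hbasis, deBrangesRovnyakKernel,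
    Matrix.of_apply]
  linear_combination -inner ℂ (h a) (h b) * hKe a.1 b.1

theorem exists_isRealization_of_contraction [CompleteSpace G]
    {T : WithLp 2 (EuclideanSpace ℂ ι × Completion (E ⊗[ℂ] G)) →L[ℂ]
      WithLp 2 (EuclideanSpace ℂ κ × G)} (hT : ‖T‖ ≤ 1) {e : X → E} (he : ∀ x, ‖e x‖ < 1) :
    ∃ (S : X → Matrix ι κ ℂ) (h : X × ι → G), IsRealization T e S h := by
  choose h hh _ using fun a : X × ι ↦ existsUnique_state hT
    ((norm_tensorLeft_le (G := G) (e a.1)).trans_lt (he a.1)) (EuclideanSpace.single a.2 (1 : ℂ))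
  refine ⟨fun x ↦ Matrix.of fun i l ↦ star ((T (colligationInput e h (x, i))).fst l), h,
    fun a ↦ WithLp.ofLp_injective 2 (Prod.ext ?_ (hh a))⟩
  ext l
  simp [colligationOutput, conjRow]

theorem exists_isRealization_of_eq_mul_inner [CompleteSpace G] {K : X → X → ℂ} {e : X → E}
    {c : ℝ} (hc : c ≠ 0) (hKe : ∀ x y, K x y * (1 - inner ℂ (e x) (e y)) = c)
    {S : X → Matrix ι κ ℂ} {g : X × ι → G}
    (hg : ∀ a b, deBrangesRovnyakKernel K S a b = c * inner ℂ (g a) (g b)) :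
    ∃ T : WithLp 2 (EuclideanSpace ℂ ι × Completion (E ⊗[ℂ] G)) →L[ℂ]
      WithLp 2 (EuclideanSpace ℂ κ × G), ‖T‖ ≤ 1 ∧ IsRealization T e S g := by
  refine (posSemidef_gram_sub_gram_iff_exists_contraction _ _).mp ?_
  have hgram :
      Matrix.gram ℂ (colligationInput e g) - Matrix.gram ℂ (colligationOutput S g) = 0 := by
    ext a b
    have hK : K a.1 b.1 ≠ 0 :=
      left_ne_zero_of_mul (hKe a.1 b.1 ▸ Complex.ofReal_ne_zero.mpr hc)
    refine (mul_eq_zero.mp ?_).resolve_left hK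
    rw [mul_gram_colligationInput_sub_gram_colligationOutput hKe, hg, sub_self]
  exact hgram ▸ Matrix.PosSemidef.zero

namespace IsRealization

variable {T : WithLp 2 (EuclideanSpace ℂ ι × Completion (E ⊗[ℂ] G)) →L[ℂ]
  WithLp 2 (EuclideanSpace ℂ κ × G)} {e : X → E} {S : X → Matrix ι κ ℂ} {h : X × ι → G}

omit [Fintype ι] [Fintype κ] in
theorem comp {Y : Type*} (hS : IsRealization T e S h) (w : Y → X) :
    IsRealization T (e ∘ w) (S ∘ w) (h ∘ Prod.map w id) :=
  fun a ↦ hS (Prod.map w id a)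

theorem unique [CompleteSpace G] (hT : ‖T‖ ≤ 1) (he : ∀ x, ‖e x‖ < 1)
    (hS : IsRealization T e S h) {S' : X → Matrix ι κ ℂ} {h' : X × ι → G}
    (hS' : IsRealization T e S' h') : S = S' := by
  have hstate : h = h' := funext fun a ↦
    (existsUnique_state hT ((norm_tensorLeft_le (G := G) (e a.1)).trans_lt (he a.1))
      (EuclideanSpace.single a.2 (1 : ℂ))).unique
      (congrArg WithLp.snd (hS a)) (congrArg WithLp.snd (hS' a))
  subst hstate
  exact funext fun x ↦ conjRow_injective <| funext fun i ↦
    congrArg WithLp.fst ((hS (x, i)).symm.trans (hS' (x, i)))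

theorem posSemidef_deBrangesRovnyakKernel [CompleteSpace G] (hT : ‖T‖ ≤ 1)
    (hS : IsRealization T e S h) {K : X → X → ℂ} (hK : IsPosDefKernel K) {c : ℝ} (hc : 0 ≤ c)
    (hKe : ∀ x y, K x y * (1 - inner ℂ (e x) (e y)) = c) :
    (deBrangesRovnyakKernel K S).PosSemidef := by
  have hgram : (Matrix.gram ℂ (colligationInput e h) -
      Matrix.gram ℂ (colligationOutput S h)).PosSemidef :=
    (posSemidef_gram_sub_gram_iff_exists_contraction _ _).mpr ⟨T, hT, hS⟩
  have hK' : (Matrix.of fun a b : X × ι ↦ K a.1 b.1).PosSemidef := hK.submatrix Prod.fst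
  have hdecomp : deBrangesRovnyakKernel K S =
      (Matrix.of fun a b : X × ι ↦ K a.1 b.1).hadamard (Matrix.gram ℂ (colligationInput e h) -
        Matrix.gram ℂ (colligationOutput S h)) + c • Matrix.gram ℂ h := by
    ext a b
    rw [Matrix.add_apply, Matrix.hadamard_apply, Matrix.of_apply,
      mul_gram_colligationInput_sub_gram_colligationOutput hKe]
    simp
  rw [hdecomp]
  exact (hK'.hadamard hgram).add (Matrix.PosSemidef.smul (IsPosDefKernel.of_inner h) hc)

end IsRealization

end Colligations

section PickInterpolation

variable {X : Type*} {K B : X → X → ℂ}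

theorem norm_lt_one_of_mul_one_sub_inner {E : Type*} [NormedAddCommGroup E]
    [InnerProductSpace ℂ E] (hK : IsPosDefKernel K) {e : X → E} {c : ℝ} (hc : 0 < c)
    (hKe : ∀ x y, K x y * (1 - inner ℂ (e x) (e y)) = c) (x : X) : ‖e x‖ < 1 := by
  have hmul : 0 < K x x * ((1 - ‖e x‖ ^ 2 : ℝ) : ℂ) := by
    have hx := hKe x x
    rw [inner_self_eq_norm_sq_to_K] at hx
    push_cast
    exact (Complex.zero_lt_real.mpr hc).trans_eq hx.symm
  have hpos : 0 < 1 - ‖e x‖ ^ 2 :=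
    Complex.zero_lt_real.mp (pos_of_mul_pos_right hmul hK.diag_nonneg)
  exact (sq_lt_one_iff₀ (norm_nonneg _)).mp (sub_pos.mp hpos)

theorem exists_interpolant_of_posSemidef {ι κ Y : Type*} [Finite ι] [Fintype κ] [DecidableEq ι]
    (hK : IsPosDefKernel K) (hB : IsPosDefKernel B) {c : ℝ} (hc : 0 < c)
    (hKB : ∀ x y, K x y * (1 - B x y) = c) (w : Y → X) (s : Y → Matrix ι κ ℂ)
    (hs : (deBrangesRovnyakKernel (fun i j ↦ K (w i) (w j)) s).PosSemidef) :
    ∃ S : X → Matrix ι κ ℂ, (deBrangesRovnyakKernel K S).PosSemidef ∧ S ∘ w = s := by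
  have := Fintype.ofFinite ι
  obtain ⟨E, _, _, _, e, he⟩ := hB.exists_eq_inner
  have hscaled : IsPosDefKernel fun a b : Y × ι ↦
      (c⁻¹ : ℝ) • deBrangesRovnyakKernel (fun i j ↦ K (w i) (w j)) s a b :=
    hs.smul (inv_nonneg.mpr hc.le)
  obtain ⟨G, _, _, _, g, hg⟩ := hscaled.exists_eq_inner
  have hfactor (a b) : deBrangesRovnyakKernel (fun i j ↦ K (w i) (w j)) s a b =
      c * inner ℂ (g a) (g b) := by
    rw [← hg, Complex.real_smul, Complex.ofReal_inv,
      mul_inv_cancel_left₀ (Complex.ofReal_ne_zero.mpr hc.ne')]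
  simp only [he] at hKB
  have he_lt := norm_lt_one_of_mul_one_sub_inner hK hc hKB
  obtain ⟨T, hT, hs_real⟩ := exists_isRealization_of_eq_mul_inner hc.ne'
    (e := e ∘ w) (fun i j ↦ hKB (w i) (w j)) hfactor
  obtain ⟨S, h, hS_real⟩ := exists_isRealization_of_contraction hT he_lt
  exact ⟨S, hS_real.posSemidef_deBrangesRovnyakKernel hT hK hc.le hKB,
    (hS_real.comp w).unique hT (fun i ↦ he_lt (w i)) hs_real⟩

theorem isCNPKernel_of_mul_one_sub (hK : IsPosDefKernel K) (hB : IsPosDefKernel B)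
    {c : ℝ} (hc : 0 < c) (hKB : ∀ x y, K x y * (1 - B x y) = c) : IsCNPKernel K := by
  refine ⟨hK, ?_⟩
  have : Fact (opKernel K).PosSemidef := ⟨hK.posSemidef_opKernel⟩
  intro m p q w s
  simp only [isSchurMultiplier_iff_posSemidef RKHS.OfKernel.kernel_ofKernel]
  constructor
  · rintro ⟨S, hS, hSw⟩
    obtain rfl : S ∘ w = s := funext hSw
    exact hS.submatrix (Prod.map w id)
  · intro hs
    obtain ⟨S, hS, hSw⟩ := exists_interpolant_of_posSemidef hK hB hc hKB w s hs
    exact ⟨S, hS, congrFun hSw⟩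

end PickInterpolation

section Kaluza

open PowerSeries Finset

theorem mul_succ_le_mul_succ_of_logConvex {a : ℕ → ℝ} (ha : ∀ n, 0 < a n)
    (hlog : ∀ n, a (n + 1) ^ 2 ≤ a n * a (n + 2)) {m n : ℕ} (hmn : m ≤ n) :
    a (m + 1) * a n ≤ a (n + 1) * a m := by
  have hratio : Monotone fun n ↦ a (n + 1) / a n := by
    refine monotone_nat_of_le_succ fun n ↦ ?_
    rw [div_le_div_iff₀ (ha _) (ha _), ← sq, mul_comm]
    exact hlog n
  exact (div_le_div_iff₀ (ha _) (ha _)).mp (hratio hmn)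

/-- The power series `1 - a₀ / ∑ aₙ Xⁿ`, meaningful for `a₀ ≠ 0`. Its coefficients are the
weights `bₙ` for which `K = ∑ aₙ kⁿ` and `B = ∑ bₙ kⁿ` satisfy `K (1 - B) = a₀`. -/
noncomputable def kaluzaSeries (a : ℕ → ℝ) : ℝ⟦X⟧ := 1 - C (a 0) * (mk a)⁻¹

variable {a : ℕ → ℝ}

theorem mk_mul_one_sub_kaluzaSeries (h0 : a 0 ≠ 0) :
    mk a * (1 - kaluzaSeries a) = C (a 0) := by
  have hconst : constantCoeff (mk a) ≠ 0 := by simpa using h0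
  rw [kaluzaSeries, sub_sub_cancel, mul_left_comm, PowerSeries.mul_inv_cancel _ hconst, mul_one]

theorem coeff_zero_kaluzaSeries (h0 : a 0 ≠ 0) : coeff 0 (kaluzaSeries a) = 0 := by
  simp [kaluzaSeries, h0]

theorem sum_coeff_kaluzaSeries_mul (h0 : a 0 ≠ 0) (n : ℕ) :
    ∑ k ∈ range (n + 1), coeff k (kaluzaSeries a) * a (n - k) = a n - if n = 0 then a 0 else 0 := by
  have hmul : kaluzaSeries a * mk a = mk a - C (a 0) := by
    linear_combination -mk_mul_one_sub_kaluzaSeries h0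
  have hcoeff := congrArg (coeff n) hmul
  rw [coeff_mul, Nat.sum_antidiagonal_eq_sum_range_succ
    (fun k l ↦ coeff k (kaluzaSeries a) * coeff l (mk a)), map_sub, coeff_C] at hcoeff
  simpa only [coeff_mk] using hcoeff

/-- Kaluza's lemma. -/
theorem coeff_kaluzaSeries_nonneg (ha : ∀ n, 0 < a n)
    (hlog : ∀ n, a (n + 1) ^ 2 ≤ a n * a (n + 2)) (n : ℕ) : 0 ≤ coeff n (kaluzaSeries a) := by
  have h0 := (ha 0).ne'
  induction n using Nat.strong_induction_on with
  | _ n ih =>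
    rcases n with _ | n
    · exact (coeff_zero_kaluzaSeries h0).ge
    have hhead : ∑ k ∈ range (n + 1), coeff k (kaluzaSeries a) * a (n + 1 - k) ≤ a (n + 1) := by
      refine le_of_mul_le_mul_right ?_ (ha n)
      calc (∑ k ∈ range (n + 1), coeff k (kaluzaSeries a) * a (n + 1 - k)) * a n
          = ∑ k ∈ range (n + 1), coeff k (kaluzaSeries a) * (a (n + 1 - k) * a n) := by
            simp only [sum_mul, mul_assoc]
        _ ≤ ∑ k ∈ range (n + 1), coeff k (kaluzaSeries a) * (a (n + 1) * a (n - k)) := by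
            refine sum_le_sum fun k hk ↦ mul_le_mul_of_nonneg_left ?_ (ih k (mem_range.mp hk))
            rw [Nat.succ_sub (mem_range_succ_iff.mp hk)]
            exact mul_succ_le_mul_succ_of_logConvex ha hlog (n.sub_le k)
        _ = a (n + 1) * ∑ k ∈ range (n + 1), coeff k (kaluzaSeries a) * a (n - k) := by
            simp only [mul_sum, mul_left_comm]
        _ ≤ a (n + 1) * a n := by
            rw [sum_coeff_kaluzaSeries_mul h0]
            refine mul_le_mul_of_nonneg_left (sub_le_self _ ?_) (ha _).le
            split_ifs
            exacts [(ha 0).le, le_rfl]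
    have hlast := sum_coeff_kaluzaSeries_mul h0 (n + 1)
    rw [sum_range_succ, Nat.sub_self, if_neg n.succ_ne_zero, sub_zero] at hlast
    exact nonneg_of_mul_nonneg_left (by linarith) (ha 0)

theorem mul_coeff_kaluzaSeries_le (ha : ∀ n, 0 < a n)
    (hlog : ∀ n, a (n + 1) ^ 2 ≤ a n * a (n + 2)) (n : ℕ) :
    coeff n (kaluzaSeries a) * a 0 ≤ a n := by
  calc coeff n (kaluzaSeries a) * a 0
      = coeff n (kaluzaSeries a) * a (n - n) := by rw [Nat.sub_self]
    _ ≤ ∑ k ∈ range (n + 1), coeff k (kaluzaSeries a) * a (n - k) :=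
        single_le_sum (f := fun k ↦ coeff k (kaluzaSeries a) * a (n - k))
          (fun k _ ↦ mul_nonneg (coeff_kaluzaSeries_nonneg ha hlog k) (ha _).le)
          (self_mem_range_succ n)
    _ ≤ a n := by
        rw [sum_coeff_kaluzaSeries_mul (ha 0).ne']
        refine sub_le_self _ ?_
        split_ifs
        exacts [(ha 0).le, le_rfl]

theorem summable_coeff_kaluzaSeries_mul_pow (ha : ∀ n, 0 < a n)
    (hlog : ∀ n, a (n + 1) ^ 2 ≤ a n * a (n + 2)) {t : ℂ}
    (hsum : Summable fun n ↦ (a n : ℂ) * t ^ n) :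
    Summable fun n ↦ ((coeff n (kaluzaSeries a) : ℝ) : ℂ) * t ^ n := by
  refine .of_norm_bounded (hsum.norm.mul_left (a 0)⁻¹) fun n ↦ ?_
  rw [norm_mul, norm_mul, ← mul_assoc, Complex.norm_of_nonneg (ha n).le,
    Complex.norm_of_nonneg (coeff_kaluzaSeries_nonneg ha hlog n)]
  gcongr
  rw [le_inv_mul_iff₀' (ha 0)]
  exact mul_coeff_kaluzaSeries_le ha hlog n

theorem tsum_coeff_mul_mul_pow {R : Type*} [NormedCommRing R] [CompleteSpace R] {A B : R⟦X⟧}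
    {t : R} (hA : Summable fun n ↦ ‖coeff n A * t ^ n‖)
    (hB : Summable fun n ↦ ‖coeff n B * t ^ n‖) :
    ∑' n, coeff n (A * B) * t ^ n = (∑' n, coeff n A * t ^ n) * ∑' n, coeff n B * t ^ n := by
  rw [tsum_mul_tsum_eq_tsum_sum_antidiagonal_of_summable_norm hA hB]
  refine tsum_congr fun n ↦ ?_
  rw [coeff_mul, sum_mul]
  refine sum_congr rfl fun kl hkl ↦ ?_
  rw [← mem_antidiagonal.mp hkl, pow_add, mul_mul_mul_comm]

theorem hasSum_coeff_C_mul_pow {R : Type*} [Semiring R] [TopologicalSpace R] (r t : R) :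
    HasSum (fun n ↦ coeff n (C r) * t ^ n) r := by
  convert hasSum_single (f := fun n ↦ coeff n (C r) * t ^ n) 0 fun n hn ↦ by simp [coeff_C, hn]
  simp

theorem tsum_mul_one_sub_tsum_kaluzaSeries (ha : ∀ n, 0 < a n)
    (hlog : ∀ n, a (n + 1) ^ 2 ≤ a n * a (n + 2)) {t : ℂ}
    (hsum : Summable fun n ↦ (a n : ℂ) * t ^ n) :
    (∑' n, (a n : ℂ) * t ^ n) * (1 - ∑' n, ((coeff n (kaluzaSeries a) : ℝ) : ℂ) * t ^ n) =
      a 0 := by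
  let toComplex : ℝ⟦X⟧ →+* ℂ⟦X⟧ := PowerSeries.map Complex.ofRealHom
  have hsub : HasSum (fun n ↦ coeff n (toComplex (1 - kaluzaSeries a)) * t ^ n)
      (1 - ∑' n, ((coeff n (kaluzaSeries a) : ℝ) : ℂ) * t ^ n) := by
    simpa [toComplex, sub_mul] using (hasSum_coeff_C_mul_pow 1 t).sub
      (summable_coeff_kaluzaSeries_mul_pow ha hlog hsum).hasSum
  have hmk : (fun n ↦ coeff n (toComplex (mk a)) * t ^ n) = fun n ↦ (a n : ℂ) * t ^ n := by
    simp [toComplex]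
  have hC : toComplex (C (a 0)) = C (a 0 : ℂ) := by simp [toComplex]
  have hprod := tsum_coeff_mul_mul_pow (hmk ▸ hsum).norm hsub.summable.norm
  rw [hsub.tsum_eq, hmk, ← map_mul, mk_mul_one_sub_kaluzaSeries (ha 0).ne', hC,
    (hasSum_coeff_C_mul_pow _ t).tsum_eq] at hprod
  exact hprod.symm

end Kaluza

section LogConvexity

theorem convexOn_log_of_sq_derivWithin_le {D : Set ℝ} (hD : Convex ℝ D) (hD' : UniqueDiffOn ℝ D)
    {f : ℝ → ℝ} (hf : ContDiffOn ℝ 2 f D) (hpos : ∀ x ∈ D, 0 < f x)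
    (hlog : ∀ x ∈ D, derivWithin f D x ^ 2 ≤ iteratedDerivWithin 2 f D x * f x) :
    ConvexOn ℝ D fun x ↦ Real.log (f x) := by
  have hf' : ContDiffOn ℝ 1 (derivWithin f D) D := hf.derivWithin hD' (by norm_num)
  have hderiv (x) (hx : x ∈ D) : HasDerivWithinAt f (derivWithin f D x) D x :=
    (hf.differentiableOn (by norm_num) x hx).hasDerivWithinAt
  have hderiv₂ (x) (hx : x ∈ D) :
      HasDerivWithinAt (derivWithin f D) (iteratedDerivWithin 2 f D x) D x := by
    rw [iteratedDerivWithin_succ, iteratedDerivWithin_one]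
    exact (hf'.differentiableOn (by norm_num) x hx).hasDerivWithinAt
  refine convexOn_of_hasDerivWithinAt2_nonneg hD
    (f' := fun x ↦ derivWithin f D x / f x)
    (f'' := fun x ↦ (iteratedDerivWithin 2 f D x * f x - derivWithin f D x * derivWithin f D x) /
      f x ^ 2)
    (hf.continuousOn.log fun x hx ↦ (hpos x hx).ne') (fun x hx ↦ ?_) (fun x hx ↦ ?_)
    fun x hx ↦ ?_
  all_goals have hxD := interior_subset hx
  · exact ((hderiv x hxD).log (hpos x hxD).ne').mono interior_subset
  · exact ((hderiv₂ x hxD).div (hderiv x hxD) (hpos x hxD).ne').mono interior_subset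
  · rw [← sq]
    exact div_nonneg (sub_nonneg.mpr (hlog x hxD)) (sq_nonneg _)

theorem sq_midpoint_le_mul_of_convexOn_log {E : Type*} [AddCommGroup E] [Module ℝ E] {D : Set E}
    {f : E → ℝ} (hf : ConvexOn ℝ D fun x ↦ Real.log (f x)) (hpos : ∀ x ∈ D, 0 < f x) {x y : E}
    (hx : x ∈ D) (hy : y ∈ D) : f (midpoint ℝ x y) ^ 2 ≤ f x * f y := by
  have hmid : midpoint ℝ x y ∈ D := hf.1.midpoint_mem hx hy
  have hconv := hf.2 hx hy (by norm_num : (0 : ℝ) ≤ 1 / 2) (by norm_num : (0 : ℝ) ≤ 1 / 2)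
    (by norm_num)
  have hcomb : (1 / 2 : ℝ) • x + (1 / 2 : ℝ) • y = midpoint ℝ x y := by
    rw [midpoint_eq_smul_add, smul_add, invOf_eq_inv, one_div]
  rw [hcomb] at hconv
  rw [← Real.log_le_log_iff (pow_pos (hpos _ hmid) 2) (mul_pos (hpos x hx) (hpos y hy)),
    Real.log_pow, Real.log_mul (hpos x hx).ne' (hpos y hy).ne']
  simp only [smul_eq_mul] at hconv
  push_cast
  linarith

theorem natCast_succ_sq_le_mul_of_sq_derivWithin_le {f : ℝ → ℝ}
    (hf : ContDiffOn ℝ 2 f (Set.Ici 0)) (hpos : ∀ x ∈ Set.Ici (0 : ℝ), 0 < f x)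
    (hlog : ∀ x ∈ Set.Ici (0 : ℝ),
      derivWithin f (Set.Ici 0) x ^ 2 ≤ iteratedDerivWithin 2 f (Set.Ici 0) x * f x) (n : ℕ) :
    f (n + 1 : ℕ) ^ 2 ≤ f n * f (n + 2 : ℕ) := by
  have hconvex : ConvexOn ℝ (Set.Ici 0) fun x ↦ Real.log (f x) :=
    convexOn_log_of_sq_derivWithin_le (convex_Ici 0) (uniqueDiffOn_Ici 0) hf hpos hlog
  have hmid : midpoint ℝ (n : ℝ) (n + 2 : ℕ) = (n + 1 : ℕ) := by
    rw [midpoint_eq_smul_add, invOf_eq_inv, smul_eq_mul]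
    push_cast
    ring
  rw [← hmid]
  exact sq_midpoint_le_mul_of_convexOn_log hconvex hpos (Nat.cast_nonneg (α := ℝ) n)
    (Nat.cast_nonneg (α := ℝ) (n + 2))

end LogConvexity

theorem theorem9p5_general {X : Type*} {k : X → X → ℂ} (hk : IsPosDefKernel k) {a : ℕ → ℝ}
    (ha : ∀ n, 0 < a n) (hlog : ∀ n, a (n + 1) ^ 2 ≤ a n * a (n + 2))
    (hsum : ∀ x y, Summable fun n ↦ (a n : ℂ) * k x y ^ n) :
    IsCNPKernel fun x y ↦ ∑' n, (a n : ℂ) * k x y ^ n :=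
  isCNPKernel_of_mul_one_sub (hk.tsum_mul_pow (fun n ↦ (ha n).le) hsum)
    (hk.tsum_mul_pow (coeff_kaluzaSeries_nonneg ha hlog)
      fun x y ↦ summable_coeff_kaluzaSeries_mul_pow ha hlog (hsum x y))
    (ha 0) fun x y ↦ tsum_mul_one_sub_tsum_kaluzaSeries ha hlog (hsum x y)

theorem theorem9p5 (f : ℝ → ℝ)
    (hf : ContDiffOn ℝ 2 f (Set.Ici 0))
    (hpos : ∀ x ∈ Set.Ici (0 : ℝ), 0 < f x)
    (hlog : ∀ x ∈ Set.Ici (0 : ℝ),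
      (derivWithin f (Set.Ici 0) x) ^ 2 ≤ iteratedDerivWithin 2 f (Set.Ici 0) x * f x)
    (Ω : Set ℂ) (hΩ : IsOpen Ω) (hΩ' : IsConnected Ω)
    (hconv : ∀ z ∈ Ω, ∀ w ∈ Ω,
      Summable fun n : ℕ => (f n : ℂ) * (z ^ n * (starRingEnd ℂ w) ^ n)) :
    IsCNPKernel fun z w : Ω =>
      ∑' n : ℕ, (f n : ℂ) * ((z : ℂ) ^ n * (starRingEnd ℂ (w : ℂ)) ^ n) := by
  simp only [← mul_pow] at hconv ⊢
  exact theorem9p5_general (.mul_conj Subtype.val) (fun n ↦ hpos n (Set.mem_Ici.mpr n.cast_nonneg))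
    (natCast_succ_sq_le_mul_of_sq_derivWithin_le hf hpos hlog) fun z w ↦ hconv z z.2 w w.2
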